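/- Let $M\ge 1$ and let $|x^{(1)}\rangle,\dots,|x^{(M)}\rangle$ be pure (unit-norm) states of $N$ qubits, with ensemble $\rho=\frac1M\sum_{m=1}^M|x^{(m)}\rangle\langle x^{(m)}|$, and let $t\in\mathbb R$. The system consists of one control qubit and $N$ processing qubits. For $\tau\in\mathbb R$ let $$\mathcal W_{m}^{(\tau)}(\sigma)=\operatorname{Tr}_{\mathrm{data}}\!\left[e^{-i\tau|1\rangle\langle1|\otimes\mathcal S}\,\bigl(\sigma\otimes|x^{(m)}\rangle\langle x^{(m)}|\bigr)\,e^{i\tau|1\rangle\langle1|\otimes\mathcal S}\right]$$ be the channel on the system given by one controlled partial swap with a fresh $N$-qubit data register prepared in $|x^{(m)}\rangle$, where $\mathcal S$ swaps the processing and the data qubits; the data register is discarded afterwards. For $n\ge1$ batches let $\mathcal B_n=\bigl(\mathcal W_M^{(t/(nM))}\circ\cdots\circ\mathcal W_1^{(t/(nM))}\bigr)^n$, and let $\mathcal E_t(\sigma)=U\sigma U^\dagger$ with $U=e^{-it|1\rangle\langle1|\otimes\rho}$. There is a universal constant $C>0$ (independent of $N$, $M$, the states, $t$, $n$ and $\epsilon$)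 such that $\|\mathcal B_n-\mathcal E_t\|_\diamond\le C\,t^2/n$ for every $n\ge1$. Moreover, with the same $C$, for every $\epsilon>0$ there is a number of batches $n\ge 1$ with $n\le\max(1,\,C\,t^2/\epsilon)$, i.e. $n=O(t^2/\epsilon)$ subject to $n\geq 1$, such that $\|\mathcal B_n-\mathcal E_t\|_\diamond\le\epsilon$. Here $\|\cdot\|_\diamond$ is the diamond norm, $\|\Phi\|_\diamond=\sup_k\sup_{\|X\|_1\le1}\|(\mathrm{id}_k\otimes\Phi)(X)\|_1$ with $\|\cdot\|_1$ the trace norm. -/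

import Mathlib

open scoped Matrix Kronecker ENNReal

noncomputable section

/-- Labels of the computational basis of `N` qubits; the Hilbert space `(ℂ²)^{⊗N}` is
`EuclideanSpace ℂ (Qubits N)`, of dimension `2 ^ N`. -/
abbrev Qubits (N : ℕ) : Type := Fin N → Fin 2

/-- Labels of the basis of the whole system: one control (learning) qubit and `N` processing
qubits. -/
abbrev CtrlQubits (N : ℕ) : Type := Fin 2 × Qubits N

/-- Trace norm (Schatten 1-norm) of a square matrix: the sum of its singular values, which are the
square roots of the eigenvalues of `Aᴴ * A`. -/
def traceNorm {ι : Type*} [Fintype ι] [DecidableEq ι] (A : Matrix ι ι ℂ) : ℝ :=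
  ∑ i, Real.sqrt ((Matrix.isHermitian_conjTranspose_mul_self A).eigenvalues i)

/-- The map `id_κ ⊗ Φ` on operators on `ℂ^κ ⊗ ℂ^ι`: the map `Φ` is applied to every block. -/
def ampliation (κ : Type*) {ι : Type*}
    (Φ : Matrix ι ι ℂ →ₗ[ℂ] Matrix ι ι ℂ) (X : Matrix (κ × ι) (κ × ι) ℂ) :
    Matrix (κ × ι) (κ × ι) ℂ :=
  Matrix.of fun p q => Φ (Matrix.of fun i j => X (p.1, i) (q.1, j)) p.2 q.2

/-- Diamond norm of a linear map on operators: the supremum, over all finite-dimensional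
ancillas and all operators `X` of trace norm at most one, of the trace norm of
`(id ⊗ Φ) X`. It takes values in `[0, ∞]`, so no boundedness is presupposed. -/
def diamondNorm {ι : Type*} [Fintype ι] [DecidableEq ι]
    (Φ : Matrix ι ι ℂ →ₗ[ℂ] Matrix ι ι ℂ) : ℝ≥0∞ :=
  ⨆ (k : ℕ) (X : Matrix (Fin k × ι) (Fin k × ι) ℂ) (_ : traceNorm X ≤ 1),
    ENNReal.ofReal (traceNorm (ampliation (Fin k) Φ X))

/-- The rank-one operator `|ψ⟩⟨ψ|`. -/
def pureState {ι : Type*} (ψ : EuclideanSpace ℂ ι) : Matrix ι ι ℂ :=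
  Matrix.of fun i j => ψ i * star (ψ j)

/-- The ensemble `(1/M) ∑ₘ |x⁽ᵐ⁾⟩⟨x⁽ᵐ⁾|` of a batch of states. -/
def ensemble {ι : Type*} {M : ℕ} (x : Fin M → EuclideanSpace ℂ ι) : Matrix ι ι ℂ :=
  (1 / (M : ℂ)) • ∑ m, pureState (x m)

/-- The projector `|1⟩⟨1|` of the control qubit. -/
def projOne : Matrix (Fin 2) (Fin 2) ℂ := Matrix.single 1 1 1

/-- The swap operator `|a⟩|b⟩ ↦ |b⟩|a⟩` on two copies of `ℂ^ι`. -/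
def swapOp (ι : Type*) [DecidableEq ι] : Matrix (ι × ι) (ι × ι) ℂ :=
  Matrix.of fun p q => if p.1 = q.2 ∧ p.2 = q.1 then 1 else 0

/-- The propagator `e^{-iτH}` of a Hamiltonian `H`. -/
def propagator {ι : Type*} [Fintype ι] [DecidableEq ι] (τ : ℝ) (H : Matrix ι ι ℂ) :
    Matrix ι ι ℂ :=
  NormedSpace.exp ((-(Complex.I * (τ : ℂ))) • H)

/-- The channel `σ ↦ V σ V†`. -/
def conjChannel {ι : Type*} [Fintype ι] (V : Matrix ι ι ℂ) :
    Matrix ι ι ℂ →ₗ[ℂ] Matrix ι ι ℂ where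
  toFun σ := V * σ * Vᴴ
  map_add' σ σ' := by rw [Matrix.mul_add, Matrix.add_mul]
  map_smul' c σ := by simp

/-- Partial trace over the second tensor factor. -/
def partialTrace {ι κ : Type*} [Fintype κ] :
    Matrix (ι × κ) (ι × κ) ℂ →ₗ[ℂ] Matrix ι ι ℂ where
  toFun X := Matrix.of fun i j => ∑ k, X (i, k) (j, k)
  map_add' X Y := by ext i j; simp [Finset.sum_add_distrib]
  map_smul' c X := by ext i j; simp [Finset.mul_sum]

/-- Adjoining a further register prepared in `B`: the map `σ ↦ σ ⊗ B`. -/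
def adjoin {ι κ : Type*} (B : Matrix κ κ ℂ) :
    Matrix ι ι ℂ →ₗ[ℂ] Matrix (ι × κ) (ι × κ) ℂ where
  toFun σ := σ ⊗ₖ B
  map_add' σ σ' := Matrix.add_kronecker σ σ' B
  map_smul' c σ := Matrix.smul_kronecker c σ B

/-- The Hamiltonian `|1⟩⟨1| ⊗ S` of the controlled swap of `N` processing qubits with `N` data
qubits. The registers are ordered as (control, processing), data. -/
def ctrlSwapHamiltonian (N : ℕ) :
    Matrix (CtrlQubits N × Qubits N) (CtrlQubits N × Qubits N) ℂ :=
  Matrix.reindex (Equiv.prodAssoc _ _ _).symm (Equiv.prodAssoc _ _ _).symm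
    (projOne ⊗ₖ swapOp (Qubits N))

/-- One controlled partial swap of duration `τ` with a fresh data register in the state `ψ`, which
is discarded afterwards:
`σ ↦ Tr_data [e^{-iτ|1⟩⟨1|⊗S} (σ ⊗ |ψ⟩⟨ψ|) e^{iτ|1⟩⟨1|⊗S}]`. -/
def partialSwapChannel {N : ℕ} (τ : ℝ) (ψ : EuclideanSpace ℂ (Qubits N)) :
    Module.End ℂ (Matrix (CtrlQubits N) (CtrlQubits N) ℂ) :=
  partialTrace ∘ₗ conjChannel (propagator τ (ctrlSwapHamiltonian N)) ∘ₗ adjoin (pureState ψ)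

/-- One batch partial swap of duration `Δ`: `M` controlled partial swaps of duration `Δ / M`, with
data registers in the states `x⁽¹⁾, …, x⁽ᴹ⁾` in this order. The product in `Module.End` is
composition, so `W_M ⋯ W_1` applies `W_1` first. -/
def batchChannel {N M : ℕ} (Δ : ℝ) (x : Fin M → EuclideanSpace ℂ (Qubits N)) :
    Module.End ℂ (Matrix (CtrlQubits N) (CtrlQubits N) ℂ) :=
  (List.ofFn fun m => partialSwapChannel (Δ / M) (x m)).reverse.prod

/-- The protocol with `n` batches for total time `t`: the batch partial swap of duration `t / n`
is repeated `n` times. -/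
def bcQSE {N M : ℕ} (x : Fin M → EuclideanSpace ℂ (Qubits N)) (t : ℝ) (n : ℕ) :
    Module.End ℂ (Matrix (CtrlQubits N) (CtrlQubits N) ℂ) :=
  batchChannel (t / n) x ^ n

/-- The channel `σ ↦ U σ U†` with `U = e^{-it|1⟩⟨1|⊗ρ}`, where `ρ` is the ensemble of the batch. -/
def targetChannel {N M : ℕ} (x : Fin M → EuclideanSpace ℂ (Qubits N)) (t : ℝ) :
    Module.End ℂ (Matrix (CtrlQubits N) (CtrlQubits N) ℂ) :=
  conjChannel (propagator t (projOne ⊗ₖ ensemble x))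

end

noncomputable section

open scoped Matrix.Norms.L2Operator

variable {ι κ : Type*} [Fintype ι] [DecidableEq ι] [Fintype κ] [DecidableEq κ]

/-! A batch and the target evolution over the same time Δ have the same first-order part. The
identity Tr₂[S(σ ⊗ ρ)] = ρσ (`dilationMap_ctrlSwapHamiltonian`) shows that one controlled swap with
the m-th state generates the Hamiltonian |1⟩⟨1| ⊗ |x⁽ᵐ⁾⟩⟨x⁽ᵐ⁾|. The M generators, each with duration
Δ/M, add up to that of |1⟩⟨1| ⊗ ρ, whatever their order. Each side differs from identity plus
generator by at most 3Δ², with no dependence on M or N, because all Hamiltonians involved have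
operator norm at most 1. Hence one batch errs by at most 6Δ²
(`diamondBound_batchChannel_sub_targetChannel`). With Δ = t/n, telescoping over n contractions gives
n · 6(t/n)² = 6t²/n.

The estimates are made on maps σ ↦ Tr₂[A(σ ⊗ |ψ⟩⟨ψ|)B], which are bilinear in A and B, stable under
adding an ancilla, and bounded by ‖A‖‖B‖ in trace norm, by duality with the operator norm
(`diamondBound_dilationMap`). -/

/-! ### Duality of trace norm and operator norm -/

lemma norm_trace_mul_le_sum_col (C Y : Matrix ι ι ℂ) :
    ‖(C * Y).trace‖ ≤ ‖C‖ * ∑ i, ‖WithLp.toLp 2 (Y.col i)‖ := by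
  rw [Finset.mul_sum]
  refine (norm_sum_le _ _).trans (Finset.sum_le_sum fun i _ => ?_)
  have h := Matrix.l2_opNorm_mulVec C (WithLp.toLp 2 (Y.col i))
  refine le_trans ?_ h
  exact PiLp.norm_apply_le ((EuclideanSpace.equiv ι ℂ).symm (C *ᵥ Y.col i)) i

lemma norm_col_eq_sqrt {m : Type*} [Fintype m] (Y : Matrix m m ℂ) (i : m) :
    ‖WithLp.toLp 2 (Y.col i)‖ = Real.sqrt ((Yᴴ * Y) i i).re := by
  rw [EuclideanSpace.norm_eq, Matrix.mul_apply, Complex.re_sum]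
  congr 1
  refine Finset.sum_congr rfl fun j _ => ?_
  simp only [Matrix.col_apply, Matrix.conjTranspose_apply, Complex.star_def]
  rw [← Complex.normSq_eq_conj_mul_self, Complex.ofReal_re, Complex.normSq_eq_norm_sq]

/-- The Gram matrix of `X` in the basis of right singular vectors is diagonal. -/
lemma conjTranspose_mul_self_diagonalized (X : Matrix ι ι ℂ) :
    let hX := Matrix.isHermitian_conjTranspose_mul_self X
    (hX.eigenvectorUnitary : Matrix ι ι ℂ)ᴴ * (Xᴴ * X) * hX.eigenvectorUnitary =
      Matrix.diagonal fun i => ((hX.eigenvalues i : ℝ) : ℂ) := by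
  intro hX
  have h := hX.conjStarAlgAut_star_eigenvectorUnitary
  rw [Unitary.conjStarAlgAut_apply] at h
  simpa [Matrix.star_eq_conjTranspose, Function.comp_def] using h

lemma norm_le_one_of_conjTranspose_mul_self {m n : Type*} [Fintype m] [Fintype n] [DecidableEq n]
    {A : Matrix m n ℂ} (h : ‖Aᴴ * A‖ ≤ 1) : ‖A‖ ≤ 1 := by
  rw [Matrix.l2_opNorm_conjTranspose_mul_self] at h
  nlinarith [norm_nonneg A]

/-- Equality fails on an empty index type, which does occur: the ancilla `Fin 0` is allowed. -/
lemma norm_one_le_one : ‖(1 : Matrix ι ι ℂ)‖ ≤ 1 := by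
  cases isEmpty_or_nonempty ι
  · simp [Subsingleton.elim (1 : Matrix ι ι ℂ) 0]
  · simp

/-- In the basis `Q` of right singular vectors, the columns of `X * Q` have the singular values as
lengths, so the trace can be bounded column by column. -/
lemma norm_trace_mul_le (C X : Matrix ι ι ℂ) : ‖(C * X).trace‖ ≤ ‖C‖ * traceNorm X := by
  set hX := Matrix.isHermitian_conjTranspose_mul_self X
  set Q : Matrix ι ι ℂ := (hX.eigenvectorUnitary : Matrix ι ι ℂ) with hQ
  have hQQ : Q * Qᴴ = 1 := Unitary.mul_star_self_of_mem hX.eigenvectorUnitary.2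
  have hQn : ‖Qᴴ‖ ≤ 1 := by
    apply norm_le_one_of_conjTranspose_mul_self
    rw [Matrix.conjTranspose_conjTranspose, hQQ]
    exact norm_one_le_one
  have h1 : (C * X).trace = (Qᴴ * C * (X * Q)).trace := by
    rw [Matrix.mul_assoc, Matrix.trace_mul_comm Qᴴ, Matrix.mul_assoc, Matrix.mul_assoc,
      hQQ, Matrix.mul_one]
  have h2 : ∀ i, ‖WithLp.toLp 2 ((X * Q).col i)‖ = Real.sqrt (hX.eigenvalues i) := by
    intro i
    have h := congrFun (congrFun (conjTranspose_mul_self_diagonalized X) i) i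
    rw [norm_col_eq_sqrt, Matrix.conjTranspose_mul]
    rw [show Qᴴ * Xᴴ * (X * Q) = Qᴴ * (Xᴴ * X) * Q by simp only [Matrix.mul_assoc]]
    rw [h, Matrix.diagonal_apply_eq, Complex.ofReal_re]
  rw [h1]
  refine (norm_trace_mul_le_sum_col _ _).trans ?_
  simp only [h2]
  refine mul_le_mul_of_nonneg_right ?_ (Finset.sum_nonneg fun i _ => Real.sqrt_nonneg _)
  refine (norm_mul_le _ _).trans ?_
  nlinarith [norm_nonneg C]

lemma exists_norm_le_one_trace_mul_eq (X : Matrix ι ι ℂ) :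
    ∃ C : Matrix ι ι ℂ, ‖C‖ ≤ 1 ∧ (C * X).trace = (traceNorm X : ℂ) := by
  set hX := Matrix.isHermitian_conjTranspose_mul_self X
  set Q : Matrix ι ι ℂ := (hX.eigenvectorUnitary : Matrix ι ι ℂ) with hQ
  have hQQ : Qᴴ * Q = 1 := Unitary.star_mul_self_of_mem hX.eigenvectorUnitary.2
  have hQn : ‖Q‖ ≤ 1 := by
    apply norm_le_one_of_conjTranspose_mul_self
    rw [hQQ]
    exact norm_one_le_one
  have hD := conjTranspose_mul_self_diagonalized X
  change Qᴴ * (Xᴴ * X) * Q = Matrix.diagonal fun i => ((hX.eigenvalues i : ℝ) : ℂ) at hD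
  have hpos : ∀ i, 0 ≤ hX.eigenvalues i :=
    open scoped ComplexOrder in (Matrix.posSemidef_conjTranspose_mul_self X).eigenvalues_nonneg
  set s : ι → ℝ := fun i => Real.sqrt (hX.eigenvalues i) with hs
  have hss : ∀ i, hX.eigenvalues i = s i * s i := fun i => (Real.mul_self_sqrt (hpos i)).symm
  set E : Matrix ι ι ℂ := Matrix.diagonal fun i => (((s i)⁻¹ : ℝ) : ℂ) with hE
  have hEE : Eᴴ = E := by
    rw [hE, Matrix.diagonal_conjTranspose]
    congr 1
    ext i
    simp
  -- This is U† for the polar decomposition X = U|X|. The convention 0⁻¹ = 0 makes `E` a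
  -- pseudo-inverse, so U is a partial isometry when `X` is singular.
  refine ⟨Q * (E * Qᴴ * Xᴴ), ?_, ?_⟩
  · have h1 : ‖E * Qᴴ * Xᴴ‖ ≤ 1 := by
      rw [← Matrix.l2_opNorm_conjTranspose]
      apply norm_le_one_of_conjTranspose_mul_self
      rw [Matrix.conjTranspose_conjTranspose]
      simp only [Matrix.conjTranspose_mul, Matrix.conjTranspose_conjTranspose, hEE]
      rw [show E * Qᴴ * Xᴴ * (X * (Q * E)) = E * (Qᴴ * (Xᴴ * X) * Q) * E by
        simp only [Matrix.mul_assoc], hD, hE, Matrix.diagonal_mul_diagonal,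
        Matrix.diagonal_mul_diagonal, Matrix.l2_opNorm_diagonal]
      refine (pi_norm_le_iff_of_nonneg zero_le_one).2 fun i => ?_
      rw [hss i]
      norm_cast
      rcases eq_or_ne (s i) 0 with h | h
      · simp [h]
      · rw [show (s i)⁻¹ * (s i * s i) * (s i)⁻¹ = 1 by field_simp]
        simp
    exact (norm_mul_le _ _).trans (mul_le_one₀ hQn (norm_nonneg _) h1)
  · rw [Matrix.mul_assoc, Matrix.trace_mul_comm,
      show E * Qᴴ * Xᴴ * X * Q = E * (Qᴴ * (Xᴴ * X) * Q) by simp only [Matrix.mul_assoc], hD, hE,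
      Matrix.diagonal_mul_diagonal, Matrix.trace_diagonal, traceNorm, Complex.ofReal_sum]
    refine Finset.sum_congr rfl fun i _ => ?_
    change _ = ((s i : ℝ) : ℂ)
    rw [hss i]
    norm_cast
    rcases eq_or_ne (s i) 0 with h | h
    · simp [h]
    · field_simp

lemma traceNorm_nonneg (X : Matrix ι ι ℂ) : 0 ≤ traceNorm X :=
  Finset.sum_nonneg fun _ _ => Real.sqrt_nonneg _

/-- The trace norm is dual to the operator norm. -/
lemma traceNorm_le_of_forall {X : Matrix ι ι ℂ} {c : ℝ}
    (h : ∀ C : Matrix ι ι ℂ, ‖C‖ ≤ 1 → ‖(C * X).trace‖ ≤ c) : traceNorm X ≤ c := by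
  obtain ⟨C, hC, hX⟩ := exists_norm_le_one_trace_mul_eq X
  have := h C hC
  rwa [hX, Complex.norm_real, Real.norm_of_nonneg (traceNorm_nonneg X)] at this

lemma norm_trace_mul_le_traceNorm {C : Matrix ι ι ℂ} (hC : ‖C‖ ≤ 1) (X : Matrix ι ι ℂ) :
    ‖(C * X).trace‖ ≤ traceNorm X :=
  (norm_trace_mul_le C X).trans (mul_le_of_le_one_left (traceNorm_nonneg X) hC)

lemma traceNorm_add_le (X Y : Matrix ι ι ℂ) : traceNorm (X + Y) ≤ traceNorm X + traceNorm Y := by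
  refine traceNorm_le_of_forall fun C hC => ?_
  rw [Matrix.mul_add, Matrix.trace_add]
  exact (norm_add_le _ _).trans (add_le_add (norm_trace_mul_le_traceNorm hC X)
    (norm_trace_mul_le_traceNorm hC Y))

lemma traceNorm_smul_le (a : ℂ) (X : Matrix ι ι ℂ) : traceNorm (a • X) ≤ ‖a‖ * traceNorm X := by
  refine traceNorm_le_of_forall fun C hC => ?_
  rw [Matrix.mul_smul, Matrix.trace_smul, norm_smul]
  exact mul_le_mul_of_nonneg_left (norm_trace_mul_le_traceNorm hC X) (norm_nonneg a)

/-! ### Dilation maps and ancillas -/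

/-- The operator norm does not grow under `A ↦ A ⊗ 1`. -/
lemma norm_kronecker_one_le (A : Matrix ι ι ℂ) : ‖A ⊗ₖ (1 : Matrix κ κ ℂ)‖ ≤ ‖A‖ := by
  let f : Matrix ι ι ℂ →⋆ₙₐ[ℂ] Matrix (ι × κ) (ι × κ) ℂ :=
    { toFun := fun A => A ⊗ₖ (1 : Matrix κ κ ℂ)
      map_smul' := fun c A => by simp [Matrix.smul_kronecker]
      map_zero' := by simp
      map_add' := fun A B => Matrix.add_kronecker A B _
      map_mul' := fun A B => by rw [← Matrix.mul_kronecker_mul, Matrix.one_mul]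
      map_star' := fun A => by
        simp [Matrix.star_eq_conjTranspose, Matrix.conjTranspose_kronecker] }
  exact NonUnitalStarAlgHom.norm_apply_le f A

/-- The operator `1 ⊗ A` on a register and an ancilla, with the ancilla next to the first factor. -/
def ancillaLift (α : Type*) [DecidableEq α] (A : Matrix (ι × κ) (ι × κ) ℂ) :
    Matrix ((α × ι) × κ) ((α × ι) × κ) ℂ :=
  Matrix.reindex (Equiv.prodAssoc _ _ _).symm (Equiv.prodAssoc _ _ _).symm
    ((1 : Matrix α α ℂ) ⊗ₖ A)

lemma ancillaLift_apply {m n : Type*} {α : Type*} [DecidableEq α] (A : Matrix (m × n) (m × n) ℂ)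
    (p q : (α × m) × n) :
    ancillaLift α A p q = if p.1.1 = q.1.1 then A (p.1.2, p.2) (q.1.2, q.2) else 0 := by
  simp [ancillaLift, Matrix.one_apply]

/-- Tensoring with an identity is a star-homomorphism of C*-algebras, hence contractive. -/
lemma norm_ancillaLift_le {α : Type*} [Fintype α] [DecidableEq α]
    (A : Matrix (ι × κ) (ι × κ) ℂ) : ‖ancillaLift α A‖ ≤ ‖A‖ := by
  let f : Matrix (ι × κ) (ι × κ) ℂ →⋆ₙₐ[ℂ] Matrix ((α × ι) × κ) ((α × ι) × κ) ℂ :=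
    { toFun := fun A => ancillaLift α A
      map_smul' := fun c A => by ext; simp [ancillaLift_apply]
      map_zero' := by ext; simp [ancillaLift_apply]
      map_add' := fun A B => by
        ext
        simp only [ancillaLift_apply, Matrix.add_apply]
        split_ifs <;> simp
      map_mul' := fun A B => by
        simp only [ancillaLift, Matrix.reindex_apply]
        rw [Matrix.submatrix_mul_equiv, ← Matrix.mul_kronecker_mul, Matrix.one_mul]
      map_star' := fun A => by
        ext p q
        simp only [ancillaLift_apply, Matrix.star_apply, eq_comm (a := p.1.1)]
        split_ifs <;> simp }
  exact NonUnitalStarAlgHom.norm_apply_le f A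

/-- The map `σ ↦ Tr₂ [A (σ ⊗ |ψ⟩⟨ψ|) B]`. -/
def dilationMap (ψ : EuclideanSpace ℂ κ) (A B : Matrix (ι × κ) (ι × κ) ℂ) :
    Module.End ℂ (Matrix ι ι ℂ) :=
  partialTrace ∘ₗ (LinearMap.mulLeft ℂ A ∘ₗ LinearMap.mulRight ℂ B) ∘ₗ adjoin (pureState ψ)

lemma dilationMap_apply (ψ : EuclideanSpace ℂ κ) (A B : Matrix (ι × κ) (ι × κ) ℂ)
    (X : Matrix ι ι ℂ) :
    dilationMap ψ A B X = partialTrace (A * ((X ⊗ₖ pureState ψ) * B)) := rfl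

lemma trace_mul_partialTrace {m n : Type*} [Fintype m] [Fintype n] [DecidableEq n]
    (C : Matrix m m ℂ) (Y : Matrix (m × n) (m × n) ℂ) :
    (C * partialTrace Y).trace = ((C ⊗ₖ (1 : Matrix n n ℂ)) * Y).trace := by
  simp only [Matrix.trace, Matrix.diag_apply, Matrix.mul_apply, Fintype.sum_prod_type,
    partialTrace, LinearMap.coe_mk, AddHom.coe_mk, Matrix.of_apply, Matrix.kroneckerMap_apply,
    Matrix.one_apply, mul_ite, mul_one, mul_zero, ite_mul, zero_mul, Finset.sum_ite_eq,
    Finset.mem_univ, if_true, Finset.mul_sum]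
  exact Finset.sum_congr rfl fun i _ => Finset.sum_comm

/-- The isometry `v ↦ v ⊗ ψ`. -/
def tensorRight (ι : Type*) [DecidableEq ι] (ψ : EuclideanSpace ℂ κ) : Matrix (ι × κ) ι ℂ :=
  Matrix.of fun p j => if p.1 = j then ψ p.2 else 0

lemma kronecker_pureState {m n : Type*} [Fintype m] [DecidableEq m]
    (ψ : EuclideanSpace ℂ n) (X : Matrix m m ℂ) :
    X ⊗ₖ pureState ψ = tensorRight m ψ * X * (tensorRight m ψ)ᴴ := by
  ext p q
  simp [tensorRight, pureState, Matrix.mul_apply, apply_ite]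
  ring

lemma sum_mul_star_self_eq_one {n : Type*} [Fintype n] {ψ : EuclideanSpace ℂ n} (hψ : ‖ψ‖ = 1) :
    ∑ k, ψ k * star (ψ k) = 1 := by
  have h := EuclideanSpace.norm_sq_eq ψ
  rw [hψ] at h
  simp only [Complex.star_def, Complex.mul_conj, Complex.normSq_eq_norm_sq]
  norm_cast
  rw [← h, one_pow]

lemma norm_tensorRight_le {m n : Type*} [Fintype m] [DecidableEq m] [Fintype n]
    {ψ : EuclideanSpace ℂ n} (hψ : ‖ψ‖ = 1) : ‖tensorRight m ψ‖ ≤ 1 := by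
  apply norm_le_one_of_conjTranspose_mul_self
  have : (tensorRight m ψ)ᴴ * tensorRight m ψ = 1 := by
    ext i j
    simp only [Matrix.mul_apply, Fintype.sum_prod_type, tensorRight, Matrix.conjTranspose_apply,
      Matrix.of_apply, apply_ite star, star_zero, ite_mul, zero_mul, mul_ite, mul_zero]
    rcases eq_or_ne i j with rfl | h
    · simpa [mul_comm] using sum_mul_star_self_eq_one hψ
    · simp [h, h.symm]
  rw [this]
  exact norm_one_le_one

/-- Pass to the Heisenberg picture: by cyclicity of the trace, testing the output against `C` is
testing `X` against J†B(C ⊗ 1)AJ, where J is the isometry v ↦ v ⊗ ψ. -/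
lemma traceNorm_dilationMap_le {ψ : EuclideanSpace ℂ κ} (hψ : ‖ψ‖ = 1)
    (A B : Matrix (ι × κ) (ι × κ) ℂ) (X : Matrix ι ι ℂ) :
    traceNorm (dilationMap ψ A B X) ≤ ‖A‖ * ‖B‖ * traceNorm X := by
  refine traceNorm_le_of_forall fun C hC => ?_
  set J := tensorRight ι ψ
  have hJ : ‖J‖ ≤ 1 := norm_tensorRight_le hψ
  have hJ' : ‖Jᴴ‖ ≤ 1 := by rwa [Matrix.l2_opNorm_conjTranspose]
  have hC' : ‖C ⊗ₖ (1 : Matrix κ κ ℂ)‖ ≤ 1 := (norm_kronecker_one_le C).trans hC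
  set D := C ⊗ₖ (1 : Matrix κ κ ℂ)
  have h : (C * dilationMap ψ A B X).trace = ((Jᴴ * (B * D * A) * J) * X).trace := by
    rw [dilationMap_apply, trace_mul_partialTrace, kronecker_pureState]
    calc (D * (A * (J * X * Jᴴ * B))).trace
        = (((D * A) * (J * X)) * (Jᴴ * B)).trace := by simp only [Matrix.mul_assoc]
      _ = ((Jᴴ * B) * ((D * A) * (J * X))).trace := Matrix.trace_mul_comm _ _
      _ = _ := by simp only [Matrix.mul_assoc]
  rw [h]
  refine (norm_trace_mul_le _ X).trans (mul_le_mul_of_nonneg_right ?_ (traceNorm_nonneg X))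
  calc ‖Jᴴ * (B * D * A) * J‖ ≤ ‖Jᴴ * (B * D * A)‖ * ‖J‖ := Matrix.l2_opNorm_mul _ _
    _ ≤ ‖Jᴴ * (B * D * A)‖ := mul_le_of_le_one_right (norm_nonneg _) hJ
    _ ≤ ‖Jᴴ‖ * ‖B * D * A‖ := Matrix.l2_opNorm_mul _ _
    _ ≤ ‖B * D * A‖ := mul_le_of_le_one_left (norm_nonneg _) hJ'
    _ ≤ ‖B * D‖ * ‖A‖ := norm_mul_le _ _
    _ ≤ (‖B‖ * ‖D‖) * ‖A‖ := mul_le_mul_of_nonneg_right (norm_mul_le _ _) (norm_nonneg _)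
    _ ≤ ‖B‖ * ‖A‖ := mul_le_mul_of_nonneg_right
        (mul_le_of_le_one_right (norm_nonneg _) hC') (norm_nonneg _)
    _ = ‖A‖ * ‖B‖ := mul_comm _ _

/-- Since an ancilla only enlarges the system, trace-norm bounds for dilation maps become
diamond-norm bounds with the same constant. -/
lemma ampliation_dilationMap {α : Type*} [Fintype α] [DecidableEq α] (ψ : EuclideanSpace ℂ κ)
    (A B : Matrix (ι × κ) (ι × κ) ℂ) (X : Matrix (α × ι) (α × ι) ℂ) :
    ampliation α (dilationMap ψ A B) X =
      dilationMap ψ (ancillaLift α A) (ancillaLift α B) X := by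
  ext p q
  simp only [ampliation, Matrix.of_apply, dilationMap_apply, partialTrace, LinearMap.coe_mk,
    AddHom.coe_mk, Matrix.mul_apply, Fintype.sum_prod_type, ancillaLift_apply,
    Matrix.kroneckerMap_apply, ite_mul, zero_mul, mul_ite, mul_zero]
  refine Finset.sum_congr rfl fun k _ => ?_
  simp only [Finset.sum_ite_irrel, Finset.sum_const_zero, Finset.sum_ite_eq, Finset.sum_ite_eq',
    Finset.mem_univ, if_true]

/-! ### Calculus of diamond-norm bounds -/

/-- `Φ` increases trace norms by a factor of at most `c`, also in the presence of an ancilla. -/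
def DiamondBound (Φ : Module.End ℂ (Matrix ι ι ℂ)) (c : ℝ) : Prop :=
  ∀ (k : ℕ) (X : Matrix (Fin k × ι) (Fin k × ι) ℂ),
    traceNorm (ampliation (Fin k) Φ X) ≤ c * traceNorm X

/-- Only upper bounds are needed, so all estimates use real constants and enter `ℝ≥0∞` here. -/
lemma diamondNorm_le {Φ : Module.End ℂ (Matrix ι ι ℂ)} {c : ℝ} (hc : 0 ≤ c)
    (h : DiamondBound Φ c) : diamondNorm Φ ≤ ENNReal.ofReal c :=
  iSup_le fun k => iSup_le fun X => iSup_le fun hX =>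
    ENNReal.ofReal_le_ofReal ((h k X).trans (mul_le_of_le_one_right hc hX))

namespace DiamondBound

variable {Φ Ψ : Module.End ℂ (Matrix ι ι ℂ)} {a b : ℝ}

lemma mono (h : DiamondBound Φ a) (hab : a ≤ b) : DiamondBound Φ b := fun k X =>
  (h k X).trans (mul_le_mul_of_nonneg_right hab (traceNorm_nonneg X))

lemma add (hΦ : DiamondBound Φ a) (hΨ : DiamondBound Ψ b) : DiamondBound (Φ + Ψ) (a + b) := by
  intro k X
  have : ampliation (Fin k) (Φ + Ψ) X = ampliation (Fin k) Φ X + ampliation (Fin k) Ψ X := rfl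
  rw [this, add_mul]
  exact (traceNorm_add_le _ _).trans (add_le_add (hΦ k X) (hΨ k X))

lemma smul (c : ℂ) (hΦ : DiamondBound Φ a) : DiamondBound (c • Φ) (‖c‖ * a) := by
  intro k X
  have : ampliation (Fin k) (c • Φ) X = c • ampliation (Fin k) Φ X := rfl
  rw [this, mul_assoc]
  exact (traceNorm_smul_le _ _).trans (mul_le_mul_of_nonneg_left (hΦ k X) (norm_nonneg c))

lemma neg (hΦ : DiamondBound Φ a) : DiamondBound (-Φ) a := by
  have e : (-1 : ℂ) • Φ = -Φ := by
    ext1 X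
    exact neg_one_smul ℂ (Φ X)
  have h := hΦ.smul (-1)
  rwa [e, norm_neg, norm_one, one_mul] at h

lemma sub (hΦ : DiamondBound Φ a) (hΨ : DiamondBound Ψ b) : DiamondBound (Φ - Ψ) (a + b) := by
  rw [sub_eq_add_neg]
  exact hΦ.add hΨ.neg

lemma mul (hΦ : DiamondBound Φ a) (hΨ : DiamondBound Ψ b) (ha : 0 ≤ a) :
    DiamondBound (Φ * Ψ) (a * b) := by
  intro k X
  have : ampliation (Fin k) (Φ * Ψ) X = ampliation (Fin k) Φ (ampliation (Fin k) Ψ X) := rfl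
  rw [this, mul_assoc]
  exact (hΦ k _).trans (mul_le_mul_of_nonneg_left (hΨ k X) ha)

lemma one : DiamondBound (1 : Module.End ℂ (Matrix ι ι ℂ)) 1 := fun k X => by
  rw [one_mul]
  exact le_of_eq (congrArg traceNorm (by ext; rfl))

lemma zero : DiamondBound (0 : Module.End ℂ (Matrix ι ι ℂ)) 0 := by
  simpa using (one (ι := ι)).smul 0

lemma pow (hΦ : DiamondBound Φ 1) (n : ℕ) : DiamondBound (Φ ^ n) 1 := by
  induction n with
  | zero => simpa using one
  | succ n ih => simpa [pow_succ] using ih.mul hΦ zero_le_one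

lemma sum {β : Type*} (s : Finset β) {F : β → Module.End ℂ (Matrix ι ι ℂ)}
    (h : ∀ i ∈ s, DiamondBound (F i) a) : DiamondBound (∑ i ∈ s, F i) (s.card * a) := by
  classical
  induction s using Finset.induction_on with
  | empty => simpa using zero
  | insert i s hi ih =>
    rw [Finset.sum_insert hi, Finset.card_insert_of_notMem hi]
    refine ((h i (Finset.mem_insert_self i s)).add
      (ih fun j hj => h j (Finset.mem_insert_of_mem hj))).mono (le_of_eq ?_)
    push_cast
    ring

/-- Errors of powers of contractions accumulate linearly. -/
lemma pow_sub_pow (hΦ : DiamondBound Φ 1) (hΨ : DiamondBound Ψ 1) (h : DiamondBound (Φ - Ψ) a)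
    (ha : 0 ≤ a) (n : ℕ) : DiamondBound (Φ ^ n - Ψ ^ n) (n * a) := by
  induction n with
  | zero => simpa using zero
  | succ n ih =>
    -- Telescoping: each single-step error is flanked by contractions.
    have : Φ ^ (n + 1) - Ψ ^ (n + 1) = Φ ^ n * (Φ - Ψ) + (Φ ^ n - Ψ ^ n) * Ψ := by
      simp only [pow_succ, mul_sub, sub_mul]
      abel
    rw [this]
    refine (((hΦ.pow n).mul h zero_le_one).add (ih.mul hΨ (by positivity))).mono (le_of_eq ?_)
    push_cast
    ring

end DiamondBound

lemma diamondBound_dilationMap {ψ : EuclideanSpace ℂ κ} (hψ : ‖ψ‖ = 1)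
    (A B : Matrix (ι × κ) (ι × κ) ℂ) : DiamondBound (dilationMap ψ A B) (‖A‖ * ‖B‖) := by
  intro k X
  rw [ampliation_dilationMap]
  refine (traceNorm_dilationMap_le hψ _ _ X).trans
    (mul_le_mul_of_nonneg_right ?_ (traceNorm_nonneg X))
  exact mul_le_mul (norm_ancillaLift_le A) (norm_ancillaLift_le B) (norm_nonneg _) (norm_nonneg _)

/-! ### First-order expansion of dilated channels and their products -/

lemma dilationMap_add_left (ψ : EuclideanSpace ℂ κ) (A A' B : Matrix (ι × κ) (ι × κ) ℂ) :
    dilationMap ψ (A + A') B = dilationMap ψ A B + dilationMap ψ A' B := by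
  ext1 X
  simp only [LinearMap.add_apply, dilationMap_apply, Matrix.add_mul, map_add]

lemma dilationMap_add_right (ψ : EuclideanSpace ℂ κ) (A B B' : Matrix (ι × κ) (ι × κ) ℂ) :
    dilationMap ψ A (B + B') = dilationMap ψ A B + dilationMap ψ A B' := by
  ext1 X
  simp only [LinearMap.add_apply, dilationMap_apply, Matrix.mul_add, map_add]

lemma partialTrace_kronecker_pureState {m n : Type*} [Fintype n]
    {ψ : EuclideanSpace ℂ n} (hψ : ‖ψ‖ = 1)
    (X : Matrix m m ℂ) : partialTrace (X ⊗ₖ pureState ψ) = X := by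
  ext i j
  simp only [partialTrace, pureState, LinearMap.coe_mk, AddHom.coe_mk, Matrix.of_apply,
    Matrix.kroneckerMap_apply]
  rw [← Finset.mul_sum, sum_mul_star_self_eq_one hψ, mul_one]

lemma dilationMap_one_one {ψ : EuclideanSpace ℂ κ} (hψ : ‖ψ‖ = 1) :
    dilationMap ψ (1 : Matrix (ι × κ) (ι × κ) ℂ) 1 = 1 := by
  ext1 X
  rw [dilationMap_apply, Matrix.mul_one, Matrix.one_mul, partialTrace_kronecker_pureState hψ]
  rfl

lemma conjTranspose_dilationMap (ψ : EuclideanSpace ℂ κ) (A B : Matrix (ι × κ) (ι × κ) ℂ)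
    (X : Matrix ι ι ℂ) : (dilationMap ψ A B X)ᴴ = dilationMap ψ Bᴴ Aᴴ Xᴴ := by
  have hpt : ∀ Y : Matrix (ι × κ) (ι × κ) ℂ, (partialTrace Y)ᴴ = partialTrace Yᴴ := fun Y => by
    ext i j
    simp [partialTrace]
  have hP : (pureState ψ)ᴴ = pureState ψ := by
    ext i j
    simp [pureState, mul_comm]
  rw [dilationMap_apply, dilationMap_apply, hpt, Matrix.conjTranspose_mul,
    Matrix.conjTranspose_mul, Matrix.conjTranspose_kronecker, hP, Matrix.mul_assoc]

/-- The map `σ ↦ G σ + σ G†`. -/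
def hamiltonianGenerator (G : Matrix ι ι ℂ) : Module.End ℂ (Matrix ι ι ℂ) :=
  LinearMap.mulLeft ℂ G + LinearMap.mulRight ℂ Gᴴ

lemma hamiltonianGenerator_sum {β : Type*} (s : Finset β) (G : β → Matrix ι ι ℂ) :
    hamiltonianGenerator (∑ i ∈ s, G i) = ∑ i ∈ s, hamiltonianGenerator (G i) := by
  ext1 X
  simp [hamiltonianGenerator, LinearMap.sum_apply, Matrix.conjTranspose_sum, Finset.sum_mul,
    Finset.mul_sum, Finset.sum_add_distrib]

/-- Only the left half has to be computed; the right half is its adjoint. -/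
lemma dilationMap_generator {ψ : EuclideanSpace ℂ κ} {K : Matrix (ι × κ) (ι × κ) ℂ}
    {G : Matrix ι ι ℂ} (h : ∀ X, dilationMap ψ K 1 X = G * X) :
    dilationMap ψ K 1 + dilationMap ψ 1 Kᴴ = hamiltonianGenerator G := by
  ext1 X
  have h1 : dilationMap ψ 1 Kᴴ X = X * Gᴴ := by
    have := congrArg Matrix.conjTranspose (h Xᴴ)
    rwa [conjTranspose_dilationMap, Matrix.conjTranspose_mul, Matrix.conjTranspose_one,
      Matrix.conjTranspose_conjTranspose] at this
  rw [LinearMap.add_apply, h, h1]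
  rfl

lemma diamondBound_generator {ψ : EuclideanSpace ℂ κ} (hψ : ‖ψ‖ = 1)
    {K : Matrix (ι × κ) (ι × κ) ℂ} {a : ℝ} (hK : ‖K‖ ≤ a) :
    DiamondBound (dilationMap ψ K 1 + dilationMap ψ 1 Kᴴ) (2 * a) := by
  have h1 := norm_one_le_one (ι := ι × κ)
  have hK' : ‖Kᴴ‖ ≤ a := by rwa [Matrix.l2_opNorm_conjTranspose]
  refine ((diamondBound_dilationMap hψ K 1).add (diamondBound_dilationMap hψ 1 Kᴴ)).mono ?_
  nlinarith [norm_nonneg K, norm_nonneg Kᴴ]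

lemma diamondBound_dilationMap_conj {ψ : EuclideanSpace ℂ κ} (hψ : ‖ψ‖ = 1)
    {V : Matrix (ι × κ) (ι × κ) ℂ} (hV : ‖V‖ ≤ 1) : DiamondBound (dilationMap ψ V Vᴴ) 1 := by
  refine (diamondBound_dilationMap hψ V Vᴴ).mono ?_
  rw [Matrix.l2_opNorm_conjTranspose]
  exact mul_le_one₀ hV (norm_nonneg _) hV

lemma diamondBound_dilationMap_sub_one {ψ : EuclideanSpace ℂ κ} (hψ : ‖ψ‖ = 1)
    {V : Matrix (ι × κ) (ι × κ) ℂ} {a : ℝ} (hV : ‖V‖ ≤ 1) (hV1 : ‖V - 1‖ ≤ a) :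
    DiamondBound (dilationMap ψ V Vᴴ - 1) (2 * a) := by
  have h : dilationMap ψ V Vᴴ - 1 =
      dilationMap ψ (V - 1) Vᴴ + dilationMap ψ 1 (V - 1)ᴴ := by
    obtain ⟨S, rfl⟩ : ∃ S, V = 1 + S := ⟨V - 1, by abel⟩
    rw [← dilationMap_one_one hψ]
    simp only [add_sub_cancel_left, Matrix.conjTranspose_add, Matrix.conjTranspose_one,
      dilationMap_add_left, dilationMap_add_right]
    abel
  rw [h]
  have h1 := norm_one_le_one (ι := ι × κ)
  refine ((diamondBound_dilationMap hψ _ _).add (diamondBound_dilationMap hψ _ _)).mono ?_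
  rw [Matrix.l2_opNorm_conjTranspose, Matrix.l2_opNorm_conjTranspose]
  nlinarith [norm_nonneg (V - 1), norm_nonneg V]

/-- A dilated conjugation agrees with its linearization up to a second-order error. -/
lemma diamondBound_dilationMap_sub_linearization {ψ : EuclideanSpace ℂ κ} (hψ : ‖ψ‖ = 1)
    {V K : Matrix (ι × κ) (ι × κ) ℂ} {a : ℝ} (hK : ‖K‖ ≤ a) (hV : ‖V‖ ≤ 1)
    (hV1 : ‖V - 1‖ ≤ a) (hR : ‖V - 1 - K‖ ≤ a ^ 2) :
    DiamondBound (dilationMap ψ V Vᴴ - 1 - (dilationMap ψ K 1 + dilationMap ψ 1 Kᴴ))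
      (3 * a ^ 2) := by
  -- With V = 1 + K + R, what remains is σR† + Kσ(V − 1)† + RσV†, three terms of size at most a².
  have h : dilationMap ψ V Vᴴ - 1 - (dilationMap ψ K 1 + dilationMap ψ 1 Kᴴ) =
      dilationMap ψ 1 (V - 1 - K)ᴴ + dilationMap ψ K (V - 1)ᴴ +
        dilationMap ψ (V - 1 - K) Vᴴ := by
    obtain ⟨R, rfl⟩ : ∃ R, V = 1 + K + R := ⟨V - 1 - K, by abel⟩
    rw [show 1 + K + R - 1 - K = R by abel, show 1 + K + R - 1 = K + R by abel,
      ← dilationMap_one_one hψ]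
    simp only [Matrix.conjTranspose_add, Matrix.conjTranspose_one,
      dilationMap_add_left, dilationMap_add_right]
    abel
  rw [h]
  have h1 := norm_one_le_one (ι := ι × κ)
  refine (((diamondBound_dilationMap hψ _ _).add (diamondBound_dilationMap hψ _ _)).add
    (diamondBound_dilationMap hψ _ _)).mono ?_
  simp only [Matrix.l2_opNorm_conjTranspose]
  have ha : 0 ≤ a := (norm_nonneg K).trans hK
  have e1 : ‖(1 : Matrix (ι × κ) (ι × κ) ℂ)‖ * ‖V - 1 - K‖ ≤ 1 * a ^ 2 :=
    mul_le_mul h1 hR (norm_nonneg _) zero_le_one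
  have e2 : ‖K‖ * ‖V - 1‖ ≤ a * a := mul_le_mul hK hV1 (norm_nonneg _) ha
  have e3 : ‖V - 1 - K‖ * ‖V‖ ≤ a ^ 2 * 1 := mul_le_mul hR hV (norm_nonneg _) (sq_nonneg a)
  linarith

/-- A product of `n` contractions that are `a`-close to linearizations of size `a` agrees with the
linearization of the product up to an error of order `(n a)²`. -/
lemma diamondBound_prod_sub_linearization {a : ℝ} (ha : 0 ≤ a) {n : ℕ}
    (W L : Fin n → Module.End ℂ (Matrix ι ι ℂ)) (hW : ∀ m, DiamondBound (W m) 1)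
    (hW1 : ∀ m, DiamondBound (W m - 1) (2 * a)) (hL : ∀ m, DiamondBound (L m) (2 * a))
    (hWL : ∀ m, DiamondBound (W m - 1 - L m) (3 * a ^ 2)) :
    DiamondBound ((List.ofFn W).reverse.prod - 1 - ∑ m, L m) (3 * (n * a) ^ 2) := by
  induction n with
  | zero => simpa using DiamondBound.zero
  | succ n ih =>
    have h := ih (fun m => W m.castSucc) (fun m => L m.castSucc) (fun m => hW _) (fun m => hW1 _)
      (fun m => hL _) (fun m => hWL _)
    rw [List.ofFn_succ', List.concat_eq_append, List.reverse_append, List.reverse_singleton,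
      List.singleton_append, List.prod_cons, Fin.sum_univ_castSucc]
    set P := (List.ofFn fun m : Fin n => W m.castSucc).reverse.prod
    set S := ∑ m : Fin n, L m.castSucc
    have hS : DiamondBound S (n * (2 * a)) := by
      simpa using DiamondBound.sum Finset.univ (fun m _ => hL (Fin.castSucc m))
    -- The new error is the old one, a cross term of size 2a · 2na, and the error 3a² of the last
    -- factor. Since 3n² + 4n + 3 ≤ 3(n + 1)², the quadratic bound persists.
    have e : W (Fin.last n) * P - 1 - (S + L (Fin.last n)) =
        W (Fin.last n) * (P - 1 - S) + (W (Fin.last n) - 1) * S +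
          (W (Fin.last n) - 1 - L (Fin.last n)) := by
      simp only [mul_sub, sub_mul, mul_one, one_mul]
      abel
    rw [e]
    refine ((((hW _).mul h zero_le_one).add ((hW1 _).mul hS (by positivity))).add
      (hWL _)).mono ?_
    push_cast
    nlinarith [mul_nonneg (Nat.cast_nonneg (α := ℝ) n) (sq_nonneg a)]

lemma diamondBound_list_prod {l : List (Module.End ℂ (Matrix ι ι ℂ))}
    (h : ∀ Φ ∈ l, DiamondBound Φ 1) : DiamondBound l.prod 1 := by
  induction l with
  | nil => simpa using DiamondBound.one
  | cons Φ l ih =>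
    rw [List.prod_cons]
    simpa using (h Φ (by simp)).mul (ih fun Ψ hΨ => h Ψ (by simp [hΨ])) zero_le_one

/-! ### Taylor bounds for unitary propagators -/

lemma norm_exp_le_one {K : Matrix ι ι ℂ} (hK : Kᴴ = -K) : ‖NormedSpace.exp K‖ ≤ 1 := by
  apply norm_le_one_of_conjTranspose_mul_self
  rw [← Matrix.exp_conjTranspose, hK, ← Matrix.exp_add_of_commute _ _ (Commute.refl K).neg_left,
    neg_add_cancel, NormedSpace.exp_zero]
  exact norm_one_le_one

lemma norm_exp_smul_le_one {K : Matrix ι ι ℂ} (hK : Kᴴ = -K) (s : ℝ) :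
    ‖NormedSpace.exp (s • K)‖ ≤ 1 := by
  apply norm_exp_le_one
  rw [Matrix.conjTranspose_smul, hK]
  simp

/-- Mean value inequality along s ↦ exp(sK). Skew-Hermiticity removes the usual factor exp ‖K‖, so
no smallness of the time step is required. -/
lemma norm_exp_sub_one_le {K : Matrix ι ι ℂ} (hK : Kᴴ = -K) : ‖NormedSpace.exp K - 1‖ ≤ ‖K‖ := by
  have h := norm_image_sub_le_of_norm_deriv_le_segment_01' (C := ‖K‖)
    (f := fun s : ℝ => NormedSpace.exp (s • K)) (f' := fun s : ℝ => NormedSpace.exp (s • K) * K)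
    (fun s _ => (hasDerivAt_exp_smul_const K s).hasDerivWithinAt)
    (fun s _ => (norm_mul_le _ _).trans
      (mul_le_of_le_one_left (norm_nonneg _) (norm_exp_smul_le_one hK s)))
  simpa [NormedSpace.exp_zero] using h

/-- The derivative of exp(sK) − sK is (exp(sK) − 1)K, which the first-order bound controls. -/
lemma norm_exp_sub_one_sub_le {K : Matrix ι ι ℂ} (hK : Kᴴ = -K) :
    ‖NormedSpace.exp K - 1 - K‖ ≤ ‖K‖ ^ 2 := by
  have h := norm_image_sub_le_of_norm_deriv_le_segment_01' (C := ‖K‖ ^ 2)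
    (f := fun s : ℝ => NormedSpace.exp (s • K) - s • K)
    (f' := fun s : ℝ => NormedSpace.exp (s • K) * K - (1 : ℝ) • K)
    (fun s _ => ((hasDerivAt_exp_smul_const K s).sub
      ((hasDerivAt_id s).smul_const K)).hasDerivWithinAt)
    (fun s hs => by
      have h1 : ‖NormedSpace.exp (s • K) - 1‖ ≤ ‖K‖ := by
        refine (norm_exp_sub_one_le (K := s • K) ?_).trans ?_
        · rw [Matrix.conjTranspose_smul, hK]
          simp
        · rw [norm_smul, Real.norm_of_nonneg hs.1]
          exact mul_le_of_le_one_left (norm_nonneg _) hs.2.le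
      have : NormedSpace.exp (s • K) * K - (1 : ℝ) • K = (NormedSpace.exp (s • K) - 1) * K := by
        rw [sub_mul, one_mul, one_smul]
      rw [this, sq]
      exact (norm_mul_le _ _).trans (mul_le_mul_of_nonneg_right h1 (norm_nonneg _)))
  simp only [one_smul, zero_smul, NormedSpace.exp_zero, sub_zero] at h
  rwa [sub_right_comm]

lemma conjTranspose_neg_I_smul {m : Type*} (τ : ℝ) {H : Matrix m m ℂ} (hH : Hᴴ = H) :
    ((-(Complex.I * (τ : ℂ))) • H)ᴴ = -((-(Complex.I * (τ : ℂ))) • H) := by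
  rw [Matrix.conjTranspose_smul, hH, ← neg_smul]
  simp

lemma norm_neg_I_smul_le (τ : ℝ) {H : Matrix ι ι ℂ} (hH : ‖H‖ ≤ 1) :
    ‖(-(Complex.I * (τ : ℂ))) • H‖ ≤ |τ| := by
  rw [norm_smul]
  simpa using mul_le_of_le_one_right (abs_nonneg τ) hH

lemma norm_propagator_le_one (τ : ℝ) {H : Matrix ι ι ℂ} (hH : Hᴴ = H) : ‖propagator τ H‖ ≤ 1 :=
  norm_exp_le_one (conjTranspose_neg_I_smul τ hH)

lemma norm_propagator_sub_one_le (τ : ℝ) {H : Matrix ι ι ℂ} (hH : Hᴴ = H) (hn : ‖H‖ ≤ 1) :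
    ‖propagator τ H - 1‖ ≤ |τ| :=
  (norm_exp_sub_one_le (conjTranspose_neg_I_smul τ hH)).trans (norm_neg_I_smul_le τ hn)

lemma norm_propagator_sub_one_sub_le (τ : ℝ) {H : Matrix ι ι ℂ} (hH : Hᴴ = H) (hn : ‖H‖ ≤ 1) :
    ‖propagator τ H - 1 - (-(Complex.I * (τ : ℂ))) • H‖ ≤ |τ| ^ 2 :=
  (norm_exp_sub_one_sub_le (conjTranspose_neg_I_smul τ hH)).trans
    (pow_le_pow_left₀ (norm_nonneg _) (norm_neg_I_smul_le τ hn) 2)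

lemma norm_le_one_of_projection {P : Matrix ι ι ℂ} (hP : Pᴴ = P) (hPP : P * P = P) : ‖P‖ ≤ 1 := by
  have h := Matrix.l2_opNorm_conjTranspose_mul_self P
  rw [hP, hPP] at h
  nlinarith [norm_nonneg P]

/-! ### Unitary conjugation as a dilation map -/

/-- If the data register is left alone, a dilated map is the two-sided multiplication `σ ↦ A σ B`. -/
lemma dilationMap_kronecker_one {ψ : EuclideanSpace ℂ κ} (hψ : ‖ψ‖ = 1) (A B X : Matrix ι ι ℂ) :
    dilationMap ψ (A ⊗ₖ (1 : Matrix κ κ ℂ)) (B ⊗ₖ (1 : Matrix κ κ ℂ)) X = A * X * B := by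
  rw [dilationMap_apply, ← Matrix.mul_kronecker_mul, ← Matrix.mul_kronecker_mul, Matrix.mul_one,
    Matrix.one_mul, partialTrace_kronecker_pureState hψ, Matrix.mul_assoc]

lemma dilationMap_conj_kronecker_one {ψ : EuclideanSpace ℂ κ} (hψ : ‖ψ‖ = 1)
    (V : Matrix ι ι ℂ) :
    dilationMap ψ (V ⊗ₖ (1 : Matrix κ κ ℂ)) (V ⊗ₖ (1 : Matrix κ κ ℂ))ᴴ = conjChannel V := by
  ext1 X
  rw [Matrix.conjTranspose_kronecker, Matrix.conjTranspose_one, dilationMap_kronecker_one hψ]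
  rfl

/-- A one-dimensional data register lets the dilation estimates apply to plain conjugations. -/
lemma exists_unit_vector : ∃ ψ : EuclideanSpace ℂ Unit, ‖ψ‖ = 1 :=
  ⟨EuclideanSpace.single () 1, by simp⟩

lemma diamondBound_conjChannel {V : Matrix ι ι ℂ} (hV : ‖V‖ ≤ 1) :
    DiamondBound (conjChannel V) 1 := by
  obtain ⟨ψ, hψ⟩ := exists_unit_vector
  rw [← dilationMap_conj_kronecker_one hψ]
  exact diamondBound_dilationMap_conj hψ ((norm_kronecker_one_le V).trans hV)

lemma diamondBound_conjChannel_sub_linearization (τ : ℝ) {H : Matrix ι ι ℂ} (hH : Hᴴ = H)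
    (hn : ‖H‖ ≤ 1) :
    DiamondBound (conjChannel (propagator τ H) - 1 -
      hamiltonianGenerator ((-(Complex.I * (τ : ℂ))) • H)) (3 * |τ| ^ 2) := by
  obtain ⟨ψ, hψ⟩ := exists_unit_vector
  set K := (-(Complex.I * (τ : ℂ))) • H with hK
  have e1 : (1 : Matrix (ι × Unit) (ι × Unit) ℂ) = (1 : Matrix ι ι ℂ) ⊗ₖ (1 : Matrix Unit Unit ℂ) :=
    Matrix.one_kronecker_one.symm
  have hg : dilationMap ψ (K ⊗ₖ (1 : Matrix Unit Unit ℂ)) 1 +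
      dilationMap ψ 1 (K ⊗ₖ (1 : Matrix Unit Unit ℂ))ᴴ = hamiltonianGenerator K :=
    dilationMap_generator fun X => by rw [e1, dilationMap_kronecker_one hψ, Matrix.mul_one]
  rw [← dilationMap_conj_kronecker_one hψ, ← hg]
  have hsub : ∀ A B : Matrix ι ι ℂ, A ⊗ₖ (1 : Matrix Unit Unit ℂ) - B ⊗ₖ (1 : Matrix Unit Unit ℂ) =
      (A - B) ⊗ₖ (1 : Matrix Unit Unit ℂ) := fun A B => by
    rw [sub_eq_iff_eq_add, ← Matrix.add_kronecker, sub_add_cancel]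
  refine diamondBound_dilationMap_sub_linearization hψ
    ((norm_kronecker_one_le _).trans (norm_neg_I_smul_le τ hn))
    ((norm_kronecker_one_le _).trans (norm_propagator_le_one τ hH)) ?_ ?_
  · rw [e1, hsub]
    exact (norm_kronecker_one_le _).trans (norm_propagator_sub_one_le τ hH hn)
  · rw [e1, hsub, hsub]
    exact (norm_kronecker_one_le _).trans (norm_propagator_sub_one_sub_le τ hH hn)

/-! ### The controlled swap and the ensemble Hamiltonian -/

lemma projOne_conjTranspose : projOneᴴ = projOne := by
  simp [projOne, Matrix.conjTranspose_single]

lemma projOne_mul_self : projOne * projOne = projOne := by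
  simp [projOne]

lemma ctrlSwapHamiltonian_conjTranspose (N : ℕ) :
    (ctrlSwapHamiltonian N)ᴴ = ctrlSwapHamiltonian N := by
  have hs : (swapOp (Qubits N))ᴴ = swapOp (Qubits N) := by
    ext p q
    simp [swapOp, eq_comm, and_comm, apply_ite]
  rw [ctrlSwapHamiltonian, Matrix.conjTranspose_reindex, Matrix.conjTranspose_kronecker, hs,
    projOne_conjTranspose]

/-- As S² = 1, the square of this Hermitian matrix is the projection |1⟩⟨1| ⊗ 1. -/
lemma norm_ctrlSwapHamiltonian_le (N : ℕ) : ‖ctrlSwapHamiltonian N‖ ≤ 1 := by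
  have hs : swapOp (Qubits N) * swapOp (Qubits N) = 1 := by
    ext p q
    simp only [swapOp, Matrix.mul_apply, Matrix.of_apply, Fintype.sum_prod_type, Matrix.one_apply,
      Prod.ext_iff, ite_and, mul_ite, mul_one, mul_zero]
    simp
  apply norm_le_one_of_conjTranspose_mul_self
  rw [ctrlSwapHamiltonian_conjTranspose, ctrlSwapHamiltonian, Matrix.reindex_apply,
    Matrix.submatrix_mul_equiv, ← Matrix.mul_kronecker_mul, hs, projOne_mul_self]
  apply norm_le_one_of_projection
  · rw [Matrix.conjTranspose_submatrix, Matrix.conjTranspose_kronecker, projOne_conjTranspose,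
      Matrix.conjTranspose_one]
  · rw [Matrix.submatrix_mul_equiv, ← Matrix.mul_kronecker_mul, projOne_mul_self, Matrix.mul_one]

/-- The swap trick, the reason the protocol works: tracing out the data turns a swap into
multiplication by the data state. -/
lemma dilationMap_ctrlSwapHamiltonian {N : ℕ} (ψ : EuclideanSpace ℂ (Qubits N))
    (X : Matrix (CtrlQubits N) (CtrlQubits N) ℂ) :
    dilationMap ψ (ctrlSwapHamiltonian N) 1 X = (projOne ⊗ₖ pureState ψ) * X := by
  ext ⟨a, p⟩ ⟨b, q⟩
  rw [dilationMap_apply, Matrix.mul_one]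
  simp only [partialTrace, LinearMap.coe_mk, AddHom.coe_mk, Matrix.of_apply, Matrix.mul_apply,
    Fintype.sum_prod_type, ctrlSwapHamiltonian, Matrix.reindex_apply, Matrix.submatrix_apply,
    Equiv.symm_symm, Equiv.prodAssoc_apply, Matrix.kroneckerMap_apply, swapOp, pureState,
    ite_and, mul_ite, ite_mul, mul_one, mul_zero, zero_mul]
  rw [Finset.sum_comm]
  refine Finset.sum_congr rfl fun c _ => ?_
  rw [Finset.sum_comm]
  refine Finset.sum_congr rfl fun d _ => ?_
  simp
  ring

lemma norm_projOne_kronecker_pureState_le {N : ℕ} {ψ : EuclideanSpace ℂ (Qubits N)}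
    (hψ : ‖ψ‖ = 1) : ‖projOne ⊗ₖ pureState ψ‖ ≤ 1 := by
  have h1 : (pureState ψ)ᴴ = pureState ψ := by
    ext i j
    simp [pureState, mul_comm]
  have h2 : pureState ψ * pureState ψ = pureState ψ := by
    ext i j
    have : ∀ k, ψ i * star (ψ k) * (ψ k * star (ψ j)) =
      (ψ i * star (ψ j)) * (ψ k * star (ψ k)) := fun k => by ring
    simp only [pureState, Matrix.mul_apply, Matrix.of_apply, this]
    rw [← Finset.mul_sum, sum_mul_star_self_eq_one hψ, mul_one]
  apply norm_le_one_of_projection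
  · rw [Matrix.conjTranspose_kronecker, projOne_conjTranspose, h1]
  · rw [← Matrix.mul_kronecker_mul, projOne_mul_self, h2]

lemma projOne_kronecker_ensemble {N M : ℕ} (x : Fin M → EuclideanSpace ℂ (Qubits N)) :
    projOne ⊗ₖ ensemble x = (1 / (M : ℂ)) • ∑ m, projOne ⊗ₖ pureState (x m) := by
  ext p q
  simp [ensemble, Matrix.sum_apply, Finset.mul_sum, mul_left_comm]

lemma projOne_kronecker_ensemble_conjTranspose {N M : ℕ}
    (x : Fin M → EuclideanSpace ℂ (Qubits N)) :
    (projOne ⊗ₖ ensemble x)ᴴ = projOne ⊗ₖ ensemble x := by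
  rw [Matrix.conjTranspose_kronecker, projOne_conjTranspose]
  congr 1
  ext i j
  simp [ensemble, Matrix.sum_apply, pureState, mul_comm]

lemma norm_projOne_kronecker_ensemble_le {N M : ℕ} (hM : 1 ≤ M)
    {x : Fin M → EuclideanSpace ℂ (Qubits N)} (hx : ∀ m, ‖x m‖ = 1) :
    ‖projOne ⊗ₖ ensemble x‖ ≤ 1 := by
  have hM' : (0 : ℝ) < M := by exact_mod_cast hM
  rw [projOne_kronecker_ensemble, norm_smul]
  have h : ‖∑ m, projOne ⊗ₖ pureState (x m)‖ ≤ M := by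
    refine (norm_sum_le_of_le _ fun m _ => norm_projOne_kronecker_pureState_le (hx m)).trans ?_
    simp
  calc _ ≤ ‖1 / (M : ℂ)‖ * M := mul_le_mul_of_nonneg_left h (norm_nonneg _)
    _ = 1 := by
      rw [norm_div, norm_one, Complex.norm_natCast]
      field_simp

/-! ### Error of one batch -/

lemma partialSwapChannel_eq_dilationMap {N : ℕ} (τ : ℝ) (ψ : EuclideanSpace ℂ (Qubits N)) :
    partialSwapChannel τ ψ = dilationMap ψ (propagator τ (ctrlSwapHamiltonian N))
      (propagator τ (ctrlSwapHamiltonian N))ᴴ := by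
  ext1 X
  rw [dilationMap_apply, ← Matrix.mul_assoc]
  rfl

lemma diamondBound_partialSwapChannel {N : ℕ} (τ : ℝ) {ψ : EuclideanSpace ℂ (Qubits N)}
    (hψ : ‖ψ‖ = 1) : DiamondBound (partialSwapChannel τ ψ) 1 := by
  rw [partialSwapChannel_eq_dilationMap]
  exact diamondBound_dilationMap_conj hψ
    (norm_propagator_le_one τ (ctrlSwapHamiltonian_conjTranspose N))

lemma diamondBound_batchChannel_sub_targetChannel {N M : ℕ} (hM : 1 ≤ M)
    {x : Fin M → EuclideanSpace ℂ (Qubits N)} (hx : ∀ m, ‖x m‖ = 1) (Δ : ℝ) :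
    DiamondBound (batchChannel Δ x - targetChannel x Δ) (6 * Δ ^ 2) := by
  set τ : ℝ := Δ / M with hτ
  have hM' : (M : ℝ) ≠ 0 := by positivity
  have hH := ctrlSwapHamiltonian_conjTranspose N
  have hn := norm_ctrlSwapHamiltonian_le N
  set c : ℂ := -(Complex.I * (τ : ℂ)) with hc
  have hgen : ∀ m, dilationMap (x m) (c • ctrlSwapHamiltonian N) 1 +
      dilationMap (x m) 1 (c • ctrlSwapHamiltonian N)ᴴ =
        hamiltonianGenerator (c • (projOne ⊗ₖ pureState (x m))) := fun m =>
    dilationMap_generator fun X => by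
      rw [Matrix.smul_mul, ← dilationMap_ctrlSwapHamiltonian, dilationMap_apply,
        dilationMap_apply, Matrix.smul_mul, map_smul]
  -- The factor 1/M in the step duration is the normalization of the ensemble.
  have hsum : ∑ m, hamiltonianGenerator (c • (projOne ⊗ₖ pureState (x m))) =
      hamiltonianGenerator ((-(Complex.I * (Δ : ℂ))) • (projOne ⊗ₖ ensemble x)) := by
    rw [← hamiltonianGenerator_sum, ← Finset.smul_sum, projOne_kronecker_ensemble, smul_smul]
    congr 2
    rw [hc, hτ]
    push_cast
    ring
  have hbatch : DiamondBound (batchChannel Δ x - 1 -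
      hamiltonianGenerator ((-(Complex.I * (Δ : ℂ))) • (projOne ⊗ₖ ensemble x)))
      (3 * (M * |τ|) ^ 2) := by
    rw [← hsum]
    refine diamondBound_prod_sub_linearization (abs_nonneg τ) _ _
      (fun m => diamondBound_partialSwapChannel τ (hx m)) (fun m => ?_) (fun m => ?_) (fun m => ?_)
    · rw [partialSwapChannel_eq_dilationMap]
      exact diamondBound_dilationMap_sub_one (hx m) (norm_propagator_le_one τ hH)
        (norm_propagator_sub_one_le τ hH hn)
    · rw [← hgen]
      exact diamondBound_generator (hx m) (norm_neg_I_smul_le τ hn)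
    · rw [← hgen, partialSwapChannel_eq_dilationMap]
      exact diamondBound_dilationMap_sub_linearization (hx m) (norm_neg_I_smul_le τ hn)
        (norm_propagator_le_one τ hH) (norm_propagator_sub_one_le τ hH hn)
        (norm_propagator_sub_one_sub_le τ hH hn)
  have htarget := diamondBound_conjChannel_sub_linearization Δ
    (projOne_kronecker_ensemble_conjTranspose x) (norm_projOne_kronecker_ensemble_le hM hx)
  have h := hbatch.sub htarget
  -- The common first-order part cancels, leaving 3(M|τ|)² + 3Δ² with M|τ| = |Δ|.
  rw [sub_sub_sub_cancel_right, sub_sub_sub_cancel_right] at h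
  refine h.mono (le_of_eq ?_)
  rw [mul_pow, sq_abs, sq_abs, hτ]
  field_simp
  ring

/-! ### Repeated batches and the choice of their number -/

lemma propagator_div_pow (t : ℝ) {n : ℕ} (hn : 1 ≤ n) (H : Matrix ι ι ℂ) :
    propagator (t / n) H ^ n = propagator t H := by
  have hn' : (n : ℂ) ≠ 0 := by exact_mod_cast (by omega : n ≠ 0)
  rw [propagator, propagator, ← Matrix.exp_nsmul, ← Nat.cast_smul_eq_nsmul ℂ, smul_smul]
  congr 2
  push_cast
  field_simp

lemma conjChannel_pow (V : Matrix ι ι ℂ) (n : ℕ) : conjChannel (V ^ n) =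
    ((conjChannel V : Module.End ℂ (Matrix ι ι ℂ)) ^ n : Module.End ℂ (Matrix ι ι ℂ)) := by
  induction n with
  | zero =>
    ext1 X
    simp [conjChannel]
  | succ n ih =>
    rw [pow_succ' (conjChannel V : Module.End ℂ (Matrix ι ι ℂ)), ← ih, pow_succ']
    ext1 X
    simp [conjChannel, Matrix.mul_assoc]

lemma targetChannel_div_pow {N M : ℕ} (x : Fin M → EuclideanSpace ℂ (Qubits N)) (t : ℝ) {n : ℕ}
    (hn : 1 ≤ n) : targetChannel x (t / n) ^ n = targetChannel x t := by
  rw [targetChannel, ← conjChannel_pow, propagator_div_pow t hn]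
  rfl

lemma diamondNorm_bcQSE_sub_targetChannel_le {N M : ℕ} (hM : 1 ≤ M)
    {x : Fin M → EuclideanSpace ℂ (Qubits N)} (hx : ∀ m, ‖x m‖ = 1) (t : ℝ) {n : ℕ}
    (hn : 1 ≤ n) :
    diamondNorm (bcQSE x t n - targetChannel x t) ≤ ENNReal.ofReal (6 * t ^ 2 / n) := by
  have hn' : (n : ℝ) ≠ 0 := by positivity
  refine diamondNorm_le (by positivity) ?_
  have hB : DiamondBound (batchChannel (t / n) x) 1 := by
    refine diamondBound_list_prod fun Φ hΦ => ?_
    rw [List.mem_reverse, List.mem_ofFn] at hΦ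
    obtain ⟨m, rfl⟩ := hΦ
    exact diamondBound_partialSwapChannel _ (hx m)
  have hE : DiamondBound (targetChannel x (t / n)) 1 := diamondBound_conjChannel
    (norm_propagator_le_one _ (projOne_kronecker_ensemble_conjTranspose x))
  rw [← targetChannel_div_pow x t hn]
  refine (hB.pow_sub_pow hE (diamondBound_batchChannel_sub_targetChannel hM hx _)
    (by positivity) n).mono (le_of_eq ?_)
  field_simp

end

theorem theorem3 :
    ∃ C : ℝ, 0 < C ∧
      ∀ (N M : ℕ) (x : Fin M → EuclideanSpace ℂ (Qubits N)) (t : ℝ),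
        1 ≤ M → (∀ m, ‖x m‖ = 1) →
          (∀ n : ℕ, 1 ≤ n →
            diamondNorm (bcQSE x t n - targetChannel x t) ≤ ENNReal.ofReal (C * t ^ 2 / n)) ∧
          (∀ ε : ℝ, 0 < ε → ∃ n : ℕ, 1 ≤ n ∧ (n : ℝ) ≤ max 1 (C * t ^ 2 / ε) ∧
            diamondNorm (bcQSE x t n - targetChannel x t) ≤ ENNReal.ofReal ε) := by
  -- Twice the proved constant 6: the slack pays for rounding the number of batches down.
  refine ⟨12, by norm_num, fun N M x t hM hx => ⟨fun n hn => ?_, fun ε hε => ?_⟩⟩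
  · refine (diamondNorm_bcQSE_sub_targetChannel_le hM hx t hn).trans
      (ENNReal.ofReal_le_ofReal ?_)
    gcongr
    norm_num
  · have hr : 0 ≤ 12 * t ^ 2 / ε := by positivity
    -- The floor keeps n below the prescribed maximum. It still suffices: 12t²/ε < ⌊12t²/ε⌋ + 1 ≤
    -- 2n, hence 6t²/n < ε.
    refine ⟨max 1 ⌊12 * t ^ 2 / ε⌋₊, le_max_left _ _, ?_, ?_⟩
    · rw [Nat.cast_max, Nat.cast_one]
      exact max_le_max_left 1 (Nat.floor_le hr)
    · refine (diamondNorm_bcQSE_sub_targetChannel_le hM hx t (le_max_left _ _)).trans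
        (ENNReal.ofReal_le_ofReal ?_)
      have h1 : (1 : ℝ) ≤ (max 1 ⌊12 * t ^ 2 / ε⌋₊ : ℕ) := by exact_mod_cast le_max_left _ _
      have h2 : (⌊12 * t ^ 2 / ε⌋₊ : ℝ) ≤ (max 1 ⌊12 * t ^ 2 / ε⌋₊ : ℕ) := by
        exact_mod_cast le_max_right _ _
      have h3 := Nat.lt_floor_add_one (12 * t ^ 2 / ε)
      rw [div_lt_iff₀ hε] at h3
      rw [div_le_iff₀ (by linarith)]
      nlinarith
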